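/- **Setting.** Let $X\subseteq\mathbb R^n$ be a finite union of compact polytopes (convex hulls of finite sets), $U\subseteq\mathbb R^m$ a compact polytope, $f:X\to\mathbb R^n$ of class $C^2$, $g:X\to\mathbb R^{n\times m}$ of class $C^1$, and $X_I,X_T\subseteq X$ compact polytopes. Consider the constrained system $\Sigma:\ \dot x=f(x)+g(x)u$, $x\in X$, $u\in U$. A *hybrid controller* is a tuple $\mathcal C=(Q,E,(D_q)_{q\in Q},(G_e)_{e\in E},(h_q)_{q\in Q})$ with $Q$ finite, $E\subseteq Q\times Q$, compact domains $D_q\subseteq X$, compact guards $G_{(q,q')}\subseteq D_q\cap D_{q'}$, and Lipschitz maps $h_q:D_q\to U$. An *execution* of $\Sigma\|\mathcal C$ is a finite or infinite sequence $(\tau_i,q_i,x_i)_{i=0}^N$ of intervals $\tau_i=[t_i,t_{i+1}]$ with $t_i\le t_{i+1}$ (if $N<\infty$, also $\tau_N=[t_N,+\infty)$ is allowed), modes $q_i\in Q$ and differentiable maps $x_i:\tau_i\to X$ with $t_0=0$ and $x_0(t_0)\in X_I\cap D_{q_0}$; $x_i(t)\in D_{q_i}$ and $\dot x_i(t)=f(x_i(t))+g(x_i(t))h_{q_i}(x_i(t))$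 for all $t\in\tau_i$ other than its right end point; and, for $i<N$, $(q_i,q_{i+1})\in E$ and $x_i(t_{i+1})=x_{i+1}(t_{i+1})\in G_{(q_i,q_{i+1})}$. It is *infinite* if $N=\infty$ or $\tau_N=[t_N,+\infty)$, and *finite* otherwise; it is *Zeno* if $N=\infty$ and $\lim_i t_i<\infty$. An execution *extends* a finite one if it continues it, where the last interval may be prolonged and further triples may be appended. $\Sigma\|\mathcal C$ is *non-blocking* if every finite execution can be extended to an infinite one, and *non-Zeno* if it has no Zeno execution. Let $\mathcal S=\{S_p\}_{p\in P}$ be a finite triangulation of $X$: the $S_p$ are full-dimensional simplices with union $X$, and any two intersect in the convex hull of their common vertices (possibly empty). Let $\mathcal S_T\subseteq\mathcal S$ be a triangulation of $X_T$. Let $\Sigma'=\{(S_p,A_p,B_p,a_p,W_p)\}_{p\in P}$ be a hybridization of $\Sigma$: each $W_p$ is nonempty, convex and compact, and $f(x)+g(x)u-A_px-B_pu-a_p\in W_p$ for all $x\in S_p$, $u\in U$. *Exit problem* for $(S,\mathcal F,A,B,a,W)$, where $\mathcal F$ is a set of facets of the simplex $S$: find an affine $h(x)=Kx+k$ with $h(S)\subseteq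 U$ such that (i) every facet $F\notin\mathcal F$, with outward unit normal $\nu$, is blocked: $\nu\cdot(Ax+Bh(x)+a)\le-\max_{w\in W}\nu\cdot w$ for all $x\in F$; and (ii) every trajectory $x$ on $[0,\infty)$ of $\dot x=Ax+Bh(x)+a+w(t)$, with $w$ continuous and $W$-valued and $x(0)\in S$, exits $S$ in finite time: there are $T\ge0$, $\varepsilon>0$ with $x(t)\in S$ on $[0,T]$ and $x(t)\notin S$ on $(T,T+\varepsilon)$. *Invariance problem*: find a Lipschitz $h_T:X_T\to U$ such that for every $x_0\in X_T$ the equation $\dot x=f(x)+g(x)h_T(x)$, $x(0)=x_0$, has a solution in $X_T$ on $[0,\infty)$. For $\mathcal S'\subseteq\mathcal S$, let $\mathrm{cf}(S_p,\mathcal S')$ be the set of facets of $S_p$ that are also facets of a simplex of $\mathcal S'$, and let $\mathrm{adjacent}(\mathcal S')$ be the set of $S_p\in\mathcal S\setminus\mathcal S'$ with $\mathrm{cf}(S_p,\mathcal S')\ne\emptyset$. **Algorithm.** Start with $Q=\{q_T\}$, $D_{q_T}=X_T$, $h_{q_T}$ any solution of the invariance problem, $E=\emptyset$, $\mathcal S_{-1}=\emptyset$,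 $\mathcal S_0=\mathcal S_T$, $k=0$. While $\mathcal S_k\ne\mathcal S_{k-1}$: let $\mathcal S_{k+1}$ be $\mathcal S_k$ together with all $S_p\in\mathrm{adjacent}(\mathcal S_k)$ for which the exit problem for $(S_p,\mathrm{cf}(S_p,\mathcal S_k),A_p,B_p,a_p,W_p)$ has a solution. For each such $S_p$ add the mode $p$ to $Q$, with $D_p=S_p$ and $h_p$ any such solution; for each $S_{p'}\in\mathcal S_k\setminus\mathcal S_T$ with $\mathrm{cf}(S_p,\{S_{p'}\})\neq\emptyset$ add the edge $(p,p')$, with guard the union of the facets in $\mathrm{cf}(S_p,\{S_{p'}\})$; and if $\mathrm{cf}(S_p,\mathcal S_T)\ne\emptyset$ add the edge $(p,q_T)$, with guard the union of the facets in $\mathrm{cf}(S_p,\mathcal S_T)$. Then increase $k$ by $1$. When the loop ends, return $\mathcal C=(Q,E,(D_q),(G_e),(h_q))$. **Theorem.** Let $\mathcal C$ be returned by the algorithm. If $X_I\subseteq\bigcup_{q\in Q}D_q$, then $\mathcal C$ is a hybrid controller for $\Sigma$, the system $\Sigma\|\mathcal C$ is non-blocking and non-Zeno, and every infinite execution $(\tau_i,q_i,x_i)_{i=0}^N$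 satisfies: there is a finite index $i^*\le N$ such that $x_i(t)\in X_T$ for all (finite) $i$ with $i^*\le i\le N$ and all $t\in\tau_i$. -/

import Mathlib

open Set Filter Topology

/-- Euclidean space `ℝⁿ`. -/
abbrev Vec (n : ℕ) : Type := EuclideanSpace ℝ (Fin n)

/-- A compact polytope: the convex hull of a finite set of points. -/
def IsCompactPolytope {n : ℕ} (s : Set (Vec n)) : Prop :=
  ∃ t : Set (Vec n), t.Finite ∧ s = convexHull ℝ t

/-- The constrained system `x' = f(x) + g(x) u`, `x ∈ X`, `u ∈ U`, with its initial set `XI` and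
its target set `XT`. The matrices `g x` are represented by the linear maps `ℝᵐ → ℝⁿ`. Only the
values of `f` and `g` on `X` are constrained or used. -/
structure ControlSystem (n m : ℕ) where
  X : Set (Vec n)
  U : Set (Vec m)
  f : Vec n → Vec n
  g : Vec n → (Vec m →L[ℝ] Vec n)
  XI : Set (Vec n)
  XT : Set (Vec n)
  X_polytopes : ∃ F : Set (Set (Vec n)),
    F.Finite ∧ (∀ s ∈ F, IsCompactPolytope s) ∧ X = ⋃₀ F
  U_polytope : IsCompactPolytope U
  f_contDiff : ContDiffOn ℝ 2 f X
  g_contDiff : ContDiffOn ℝ 1 g X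
  XI_subset : XI ⊆ X
  XI_polytope : IsCompactPolytope XI
  XT_subset : XT ⊆ X
  XT_polytope : IsCompactPolytope XT

/-- The closed-loop vector field `f(x) + g(x) h(x)`. -/
def ControlSystem.field {n m : ℕ} (sys : ControlSystem n m) (h : Vec n → Vec m) (x : Vec n) :
    Vec n :=
  sys.f x + sys.g x (h x)

/-! ### Hybrid controllers and executions -/

/-- The data `(Q, E, D, G, H)` of a hybrid controller with modes labelled by `M`. The values `D q`
and `h q` are meaningful for `q ∈ Q` only, and `G e` for `e ∈ E` only. -/
structure HybridControllerData (n m : ℕ) (M : Type*) where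
  Q : Set M
  E : Set (M × M)
  D : M → Set (Vec n)
  G : M × M → Set (Vec n)
  h : M → Vec n → Vec m

/-- The data form a hybrid controller for `sys`. -/
structure IsHybridController {n m : ℕ} {M : Type*} (sys : ControlSystem n m)
    (C : HybridControllerData n m M) : Prop where
  finite_modes : C.Q.Finite
  edges : C.E ⊆ C.Q ×ˢ C.Q
  domain_subset : ∀ q ∈ C.Q, C.D q ⊆ sys.X
  domain_compact : ∀ q ∈ C.Q, IsCompact (C.D q)
  guard_subset : ∀ e ∈ C.E, C.G e ⊆ C.D e.1 ∩ C.D e.2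
  guard_compact : ∀ e ∈ C.E, IsCompact (C.G e)
  control_mapsTo : ∀ q ∈ C.Q, MapsTo (C.h q) (C.D q) sys.U
  control_lipschitz : ∀ q ∈ C.Q, ∃ K : NNReal, LipschitzOnWith K (C.h q) (C.D q)

/-- A sequence of triples `(τ i, q i, x i)`, `0 ≤ i ≤ N`, `i` finite, where `N` may be infinite.
If `N` is finite and `unbounded` holds, then `τ N = [t N, +∞)`; every other interval is
`τ i = [t i, t (i + 1)]`. Values at indices that do not occur are meaningless. -/
structure HybridPath (n : ℕ) (M : Type*) where
  N : ℕ∞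
  unbounded : Prop
  t : ℕ → ℝ
  q : ℕ → M
  x : ℕ → ℝ → Vec n

namespace HybridPath

variable {n : ℕ} {M : Type*}

/-- The `i`-th interval is the unbounded last one. -/
def IsUnboundedAt (e : HybridPath n M) (i : ℕ) : Prop := (i : ℕ∞) = e.N ∧ e.unbounded

/-- The time interval `τ i`. -/
def τ (e : HybridPath n M) (i : ℕ) : Set ℝ :=
  {s | e.t i ≤ s ∧ (¬ e.IsUnboundedAt i → s ≤ e.t (i + 1))}

/-- The interval `τ i` without its right end point (if it has one). -/
def τOpen (e : HybridPath n M) (i : ℕ) : Set ℝ :=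
  {s | e.t i ≤ s ∧ (¬ e.IsUnboundedAt i → s < e.t (i + 1))}

/-- Infinite executions: infinitely many transitions, or an unbounded last interval. -/
def IsInfinite (e : HybridPath n M) : Prop := e.N = ⊤ ∨ e.unbounded

/-- Infinitely many transitions whose times have a finite limit. -/
def IsZeno (e : HybridPath n M) : Prop := e.N = ⊤ ∧ ∃ L : ℝ, Tendsto e.t atTop (𝓝 L)

/-- `e'` extends `e`: the two agree on all time intervals of `e`; the last interval of `e` may be
prolonged in `e'`, and further triples may follow. -/
def Extends (e' e : HybridPath n M) : Prop :=
  e.N ≤ e'.N ∧ ∀ i : ℕ, (i : ℕ∞) ≤ e.N →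
    e'.t i = e.t i ∧ e'.q i = e.q i ∧ e.τ i ⊆ e'.τ i ∧ EqOn (e'.x i) (e.x i) (e.τ i)

end HybridPath

/-- Executions of the system `sys` controlled by `C`. -/
structure IsExecution {n m : ℕ} {M : Type*} (sys : ControlSystem n m)
    (C : HybridControllerData n m M) (e : HybridPath n M) : Prop where
  start_time : e.t 0 = 0
  start_mem : e.x 0 (e.t 0) ∈ sys.XI ∩ C.D (e.q 0)
  times : ∀ i : ℕ, (i : ℕ∞) ≤ e.N → ¬ e.IsUnboundedAt i → e.t i ≤ e.t (i + 1)
  modes : ∀ i : ℕ, (i : ℕ∞) ≤ e.N → e.q i ∈ C.Q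
  state_mem : ∀ i : ℕ, (i : ℕ∞) ≤ e.N → MapsTo (e.x i) (e.τ i) sys.X
  differentiable : ∀ i : ℕ, (i : ℕ∞) ≤ e.N → DifferentiableOn ℝ (e.x i) (e.τ i)
  flow : ∀ i : ℕ, (i : ℕ∞) ≤ e.N → ∀ s ∈ e.τOpen i,
    e.x i s ∈ C.D (e.q i) ∧
      HasDerivWithinAt (e.x i) (sys.field (C.h (e.q i)) (e.x i s)) (e.τ i) s
  jump : ∀ i : ℕ, (i : ℕ∞) < e.N →
    (e.q i, e.q (i + 1)) ∈ C.E ∧ e.x i (e.t (i + 1)) = e.x (i + 1) (e.t (i + 1)) ∧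
      e.x (i + 1) (e.t (i + 1)) ∈ C.G (e.q i, e.q (i + 1))

/-- Every finite execution can be extended to an infinite one. -/
def IsNonBlocking {n m : ℕ} {M : Type*} (sys : ControlSystem n m)
    (C : HybridControllerData n m M) : Prop :=
  ∀ e : HybridPath n M, IsExecution sys C e → ¬ e.IsInfinite →
    ∃ e' : HybridPath n M, IsExecution sys C e' ∧ e'.IsInfinite ∧ e'.Extends e

/-- There is no Zeno execution. -/
def IsNonZeno {n m : ℕ} {M : Type*} (sys : ControlSystem n m)
    (C : HybridControllerData n m M) : Prop :=
  ∀ e : HybridPath n M, IsExecution sys C e → ¬ e.IsZeno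

/-- Every infinite execution is in the target set from some index on. -/
def ReachesTarget {n m : ℕ} {M : Type*} (sys : ControlSystem n m)
    (C : HybridControllerData n m M) : Prop :=
  ∀ e : HybridPath n M, IsExecution sys C e → e.IsInfinite →
    ∃ i₀ : ℕ, (i₀ : ℕ∞) ≤ e.N ∧
      ∀ i : ℕ, i₀ ≤ i → (i : ℕ∞) ≤ e.N → ∀ s ∈ e.τ i, e.x i s ∈ sys.XT

/-- The synthesis problem: `C` is a hybrid controller whose domains cover the initial set, and the
controlled system is non-blocking, non-Zeno, and reaches the target set and stays there. -/
structure SolvesSynthesisProblem {n m : ℕ} {M : Type*} (sys : ControlSystem n m)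
    (C : HybridControllerData n m M) : Prop where
  isHybridController : IsHybridController sys C
  covers : sys.XI ⊆ ⋃ q ∈ C.Q, C.D q
  nonBlocking : IsNonBlocking sys C
  nonZeno : IsNonZeno sys C
  reaches : ReachesTarget sys C

/-! ### Simplices and triangulations -/

/-- The full-dimensional simplex spanned by the vertices of `s`, as a set. -/
def simplexBody {n : ℕ} (s : Affine.Simplex ℝ (Vec n) n) : Set (Vec n) :=
  convexHull ℝ (range s.points)

/-- The facet of `s` opposite to the vertex `j`. -/
def facet {n : ℕ} (s : Affine.Simplex ℝ (Vec n) n) (j : Fin (n + 1)) : Set (Vec n) :=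
  convexHull ℝ (s.points '' {i | i ≠ j})

/-- `ν` is the outward unit normal vector of the facet of `s` opposite to the vertex `j`. -/
def IsOutwardNormal {n : ℕ} (s : Affine.Simplex ℝ (Vec n) n) (j : Fin (n + 1)) (ν : Vec n) :
    Prop :=
  ‖ν‖ = 1 ∧
    (∀ i k : Fin (n + 1), i ≠ j → k ≠ j → inner ℝ ν (s.points i) = inner ℝ ν (s.points k)) ∧
    (∀ i : Fin (n + 1), i ≠ j → inner ℝ ν (s.points j) < inner ℝ ν (s.points i))

/-- The simplices `S p` form a triangulation of `X`. -/
def IsTriangulation {n : ℕ} {P : Type*} (S : P → Affine.Simplex ℝ (Vec n) n) (X : Set (Vec n)) :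
    Prop :=
  (∀ p p' : P, simplexBody (S p) ∩ simplexBody (S p') =
      convexHull ℝ (range (S p).points ∩ range (S p').points)) ∧
    ⋃ p, simplexBody (S p) = X

/-- The (indices of the) facets of `S p` that are also facets of a simplex `S p'`, `p' ∈ R`. -/
def commonFacets {n : ℕ} {P : Type*} (S : P → Affine.Simplex ℝ (Vec n) n) (p : P) (R : Set P) :
    Set (Fin (n + 1)) :=
  {j | ∃ p' ∈ R, ∃ j' : Fin (n + 1), facet (S p) j = facet (S p') j'}

/-- The (indices of the) simplices outside `R` that share a facet with a simplex of `R`. -/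
def adjacentSimplices {n : ℕ} {P : Type*} (S : P → Affine.Simplex ℝ (Vec n) n) (R : Set P) :
    Set P :=
  {p | p ∉ R ∧ (commonFacets S p R).Nonempty}

/-! ### Affine systems with disturbances -/

/-- The affine system `x' = A x + B u + a + w` with disturbances `w ∈ W`. -/
structure DisturbedAffineSystem (n m : ℕ) where
  A : Vec n →L[ℝ] Vec n
  B : Vec m →L[ℝ] Vec n
  a : Vec n
  W : Set (Vec n)
  W_nonempty : W.Nonempty
  W_convex : Convex ℝ W
  W_compact : IsCompact W

/-- The affine systems `L p` on the simplices `S p` form a hybridization of `sys`. -/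
def IsHybridization {n m : ℕ} {P : Type*} (sys : ControlSystem n m)
    (S : P → Affine.Simplex ℝ (Vec n) n) (L : P → DisturbedAffineSystem n m) : Prop :=
  ∀ p : P, ∀ x ∈ simplexBody (S p), ∀ u ∈ sys.U,
    sys.f x + sys.g x u - (L p).A x - (L p).B u - (L p).a ∈ (L p).W

/-- `x` is a trajectory, on `[0, +∞)`, of `x' = A x + B h(x) + a + w` for some continuous
disturbance `w` with values in `W`. -/
def IsDisturbedTrajectory {n m : ℕ} (L : DisturbedAffineSystem n m) (h : Vec n → Vec m)
    (x : ℝ → Vec n) : Prop :=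
  ∃ w : ℝ → Vec n, ContinuousOn w (Ici 0) ∧ (∀ t ∈ Ici (0 : ℝ), w t ∈ L.W) ∧
    ∀ t ∈ Ici (0 : ℝ),
      HasDerivWithinAt x (L.A (x t) + L.B (h (x t)) + L.a + w t) (Ici 0) t

/-- The trajectory `x` exits the set `K` at time `T`. -/
def ExitsAt {n : ℕ} (x : ℝ → Vec n) (K : Set (Vec n)) (T : ℝ) : Prop :=
  0 ≤ T ∧ ∃ ε > 0, (∀ t ∈ Icc 0 T, x t ∈ K) ∧ ∀ t ∈ Ioo T (T + ε), x t ∉ K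

/-- The facet `j` of `s` is blocked for `x' = A x + B h(x) + a + w`, `w ∈ W`. -/
def IsBlocked {n m : ℕ} (s : Affine.Simplex ℝ (Vec n) n) (L : DisturbedAffineSystem n m)
    (h : Vec n → Vec m) (j : Fin (n + 1)) : Prop :=
  ∀ ν : Vec n, IsOutwardNormal s j ν → ∀ x ∈ facet s j,
    inner ℝ ν (L.A x + L.B (h x) + L.a) ≤ -sSup ((fun w => inner ℝ ν w) '' L.W)

/-- `h` solves the exit problem on the simplex `s` for the facets with indices in `J`: it is an
affine feedback with values in `U` on the simplex, all facets outside `J` are blocked, and all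
trajectories that start in the simplex exit it in finite time. -/
structure SolvesExitProblem {n m : ℕ} (U : Set (Vec m)) (s : Affine.Simplex ℝ (Vec n) n)
    (J : Set (Fin (n + 1))) (L : DisturbedAffineSystem n m) (h : Vec n → Vec m) : Prop where
  affine : ∃ (K : Vec n →L[ℝ] Vec m) (k : Vec m), ∀ x, h x = K x + k
  mapsTo : MapsTo h (simplexBody s) U
  blocked : ∀ j, j ∉ J → IsBlocked s L h j
  exits : ∀ x : ℝ → Vec n, IsDisturbedTrajectory L h x → x 0 ∈ simplexBody s →
    ∃ T, ExitsAt x (simplexBody s) T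

/-- `h` solves the invariance problem: it is Lipschitz on `XT` with values in `U`, and all solutions
of the closed loop that start in `XT` are defined, in `XT`, for all nonnegative times. -/
structure SolvesInvarianceProblem {n m : ℕ} (sys : ControlSystem n m) (h : Vec n → Vec m) :
    Prop where
  lipschitz : ∃ K : NNReal, LipschitzOnWith K h sys.XT
  mapsTo : MapsTo h sys.XT sys.U
  solution : ∀ x₀ ∈ sys.XT, ∃ x : ℝ → Vec n, x 0 = x₀ ∧ ∀ t ∈ Ici (0 : ℝ),
    x t ∈ sys.XT ∧ HasDerivWithinAt x (sys.field h (x t)) (Ici 0) t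

/-! ### The synthesis algorithm

The modes are labelled by `Option P`: `none` is the target mode, and `some p` is the mode of the
simplex `S p`. -/

/-- The variables of the algorithm: the current and the previous set of (indices of) simplices, and
the controller built so far. -/
structure AlgState (n m : ℕ) (P : Type*) where
  cur : Set P
  prev : Set P
  C : HybridControllerData n m (Option P)

/-- The initialization of the algorithm. -/
structure AlgInit {n m : ℕ} {P : Type*} (sys : ControlSystem n m) (PT : Set P)
    (s : AlgState n m P) : Prop where
  cur : s.cur = PT
  prev : s.prev = ∅
  modes : s.C.Q = {none}
  edges : s.C.E = ∅
  domain : s.C.D none = sys.XT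
  control : SolvesInvarianceProblem sys (s.C.h none)

/-- The adjacent simplices that are added to `R` by one iteration: those on which the exit problem,
with the facets shared with `R`, has a solution. -/
def newSimplices {n m : ℕ} {P : Type*} (sys : ControlSystem n m)
    (S : P → Affine.Simplex ℝ (Vec n) n) (L : P → DisturbedAffineSystem n m) (R : Set P) :
    Set P :=
  {p | p ∈ adjacentSimplices S R ∧
    ∃ h, SolvesExitProblem sys.U (S p) (commonFacets S p R) (L p) h}

/-- One iteration of the loop of the algorithm, from `s` to `s'`. The controllers of the new modes
may be any solutions of the exit problems. -/
structure AlgStep {n m : ℕ} {P : Type*} (sys : ControlSystem n m)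
    (S : P → Affine.Simplex ℝ (Vec n) n) (PT : Set P) (L : P → DisturbedAffineSystem n m)
    (s s' : AlgState n m P) : Prop where
  loop : s.cur ≠ s.prev
  prev : s'.prev = s.cur
  cur : s'.cur = s.cur ∪ newSimplices sys S L s.cur
  modes : s'.C.Q = s.C.Q ∪ some '' newSimplices sys S L s.cur
  domain_new : ∀ p ∈ newSimplices sys S L s.cur, s'.C.D (some p) = simplexBody (S p)
  domain_old : ∀ q ∈ s.C.Q, s'.C.D q = s.C.D q
  control_new : ∀ p ∈ newSimplices sys S L s.cur,
    SolvesExitProblem sys.U (S p) (commonFacets S p s.cur) (L p) (s'.C.h (some p))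
  control_old : ∀ q ∈ s.C.Q, s'.C.h q = s.C.h q
  edges : s'.C.E = s.C.E ∪
    {e | ∃ p ∈ newSimplices sys S L s.cur, ∃ p' ∈ s.cur \ PT,
      (commonFacets S p {p'}).Nonempty ∧ e = (some p, some p')} ∪
    {e | ∃ p ∈ newSimplices sys S L s.cur,
      (commonFacets S p PT).Nonempty ∧ e = (some p, none)}
  guard_new : ∀ p ∈ newSimplices sys S L s.cur, ∀ p' ∈ s.cur \ PT,
    (commonFacets S p {p'}).Nonempty →
      s'.C.G (some p, some p') = ⋃ j ∈ commonFacets S p {p'}, facet (S p) j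
  guard_target : ∀ p ∈ newSimplices sys S L s.cur,
    (commonFacets S p PT).Nonempty →
      s'.C.G (some p, none) = ⋃ j ∈ commonFacets S p PT, facet (S p) j
  guard_old : ∀ e ∈ s.C.E, s'.C.G e = s.C.G e

/-- `C` is returned by a run of the algorithm: finitely many iterations lead from an initial state
to a state in which the loop condition fails, with controller `C`. -/
def ComputedByAlgorithm {n m : ℕ} {P : Type*} (sys : ControlSystem n m)
    (S : P → Affine.Simplex ℝ (Vec n) n) (PT : Set P) (L : P → DisturbedAffineSystem n m)
    (C : HybridControllerData n m (Option P)) : Prop :=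
  ∃ s₀ s : AlgState n m P, AlgInit sys PT s₀ ∧
    Relation.ReflTransGen (AlgStep sys S PT L) s₀ s ∧ s.cur = s.prev ∧ s.C = C

/-!
Every edge of the computed controller leads from a mode added at some stage to a mode added earlier,
and the target mode has no outgoing edge. Hence the modes carry a rank that every transition lowers
(`IsSynthesized.rank`), an execution has only finitely many transitions
(`IsSynthesized.ne_top`), and there is no Zeno execution. An infinite execution therefore has
an unbounded last interval. Its last mode is not a simplex: there, the closed loop is a trajectory of
the disturbed affine system of the hybridization, which would have to exit
(`SolvesExitProblem.not_forall_mem`). So the last mode is the target mode, whose domain is the target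
set.

The analytic part is the absence of blocking: from each point of a simplex, some closed-loop solution
has to reach one of the facets in the guards (`SolvesExitProblem.exists_solution_reaching_facet`).
The field is meaningful on the simplex only, and it may be tangent to blocked facets. It is
precomposed with the metric projection onto the simplex; the result is bounded and Lipschitz, so
a solution exists for all times. While this solution avoids the guards, all active facets are blocked,
the field does not point out of the simplex at the projected point
(`IsBlocked.linear_coord_nonneg`), and the squared distance to the simplex cannot grow
(`mem_of_hasDerivWithinAt_comp_projection`). Were the guards avoided forever, the solution would stay
in the simplex forever, which the exit property excludes. Prolonging an execution in this way and
appending transitions, by induction on the rank, leads to the target mode, where a solution of the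
invariance problem is followed forever (`IsSynthesized.isNonBlocking`).
-/

/-! ### Projections, differential equations and invariance of convex sets -/

/-- The metric projection `π` onto a complete convex set: a retraction that is 1-Lipschitz and makes
an obtuse angle with the set. -/
theorem exists_convex_projection {E : Type*} [NormedAddCommGroup E] [InnerProductSpace ℝ E]
    {K : Set E} (hne : K.Nonempty) (hcomp : IsComplete K) (hconv : Convex ℝ K) :
    ∃ π : E → E, LipschitzWith 1 π ∧ (∀ x, π x ∈ K) ∧ (∀ x ∈ K, π x = x) ∧
      ∀ x, ∀ z ∈ K, inner ℝ (x - π x) (z - π x) ≤ 0 := by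
  choose π hπ hmin using exists_norm_eq_iInf_of_complete_convex hne hcomp hconv
  have hobt : ∀ x, ∀ z ∈ K, inner ℝ (x - π x) (z - π x) ≤ 0 := fun x =>
    (norm_eq_iInf_iff_real_inner_le_zero hconv (hπ x)).1 (hmin x)
  refine ⟨π, ?_, hπ, ?_, hobt⟩
  · refine LipschitzWith.of_dist_le_mul fun x y => ?_
    rw [dist_eq_norm, dist_eq_norm, NNReal.coe_one, one_mul]
    have h1 := hobt x (π y) (hπ y)
    have h2 := hobt y (π x) (hπ x)
    have h3 : ‖π x - π y‖ * ‖π x - π y‖ ≤ inner ℝ (x - y) (π x - π y) := by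
      rw [← real_inner_self_eq_norm_mul_norm]
      simp only [inner_sub_left, inner_sub_right] at h1 h2 ⊢
      linarith
    have h4 := h3.trans (real_inner_le_norm _ _)
    rcases (norm_nonneg (π x - π y)).eq_or_lt with h | h
    · rw [← h]; positivity
    · exact le_of_mul_le_mul_right h4 h
  · intro x hx
    have := hobt x x hx
    rw [real_inner_self_eq_norm_sq] at this
    have h0 : ‖x - π x‖ = 0 := by nlinarith [norm_nonneg (x - π x)]
    exact (sub_eq_zero.1 (norm_eq_zero.1 h0)).symm

/-- A bounded Lipschitz vector field has a solution on `[0, +∞)` from each initial value. Since the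
field is bounded, the Picard-Lindelöf theorem applies on `[0, k]` for each `k`, and by uniqueness
these solutions agree. -/
theorem LipschitzWith.exists_forall_hasDerivWithinAt_Ici {E : Type*} [NormedAddCommGroup E]
    [NormedSpace ℝ E] [CompleteSpace E] {v : E → E} {K L : NNReal} (hv : LipschitzWith K v)
    (hL : ∀ x, ‖v x‖ ≤ L) (x₀ : E) :
    ∃ y : ℝ → E, y 0 = x₀ ∧ ∀ t ∈ Ici (0 : ℝ), HasDerivWithinAt y (v (y t)) (Ici 0) t := by
  have hloc : ∀ k : ℕ, ∃ α : ℝ → E, α 0 = x₀ ∧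
      ∀ t ∈ Icc (0 : ℝ) k, HasDerivWithinAt α (v (α t)) (Icc 0 k) t := by
    intro k
    have hp : IsPicardLindelof (fun _ => v) (⟨0, le_rfl, k.cast_nonneg⟩ : Icc (0 : ℝ) k) x₀
        (L * k) 0 L K :=
      { lipschitzOnWith := fun t _ => hv.lipschitzOnWith
        continuousOn := fun x _ => continuousOn_const
        norm_le := fun t _ x _ => hL x
        mul_max_le := by simp }
    exact hp.exists_eq_forall_mem_Icc_hasDerivWithinAt₀
  choose α hα0 hα using hloc
  have hright : ∀ k : ℕ, ∀ t ∈ Ico (0 : ℝ) k, HasDerivWithinAt (α k) (v (α k t)) (Ici t) t :=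
    fun k t ht => (hα k t (Ico_subset_Icc_self ht)).mono_of_mem_nhdsWithin
      (mem_of_superset (Icc_mem_nhdsGE ht.2) (Icc_subset_Icc_left ht.1))
  have huniq : ∀ k l : ℕ, k ≤ l → EqOn (α k) (α l) (Icc 0 k) := by
    intro k l hkl
    have hkl' : (k : ℝ) ≤ l := Nat.cast_le.2 hkl
    refine ODE_solution_unique (v := fun _ => v) (fun _ => hv)
      (fun t ht => (hα k t ht).continuousWithinAt) (hright k)
      (fun t ht => ((hα l t ⟨ht.1, ht.2.trans hkl'⟩).continuousWithinAt).mono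
        (Icc_subset_Icc_right hkl'))
      (fun t ht => hright l t ⟨ht.1, ht.2.trans_le hkl'⟩) ((hα0 k).trans (hα0 l).symm)
  refine ⟨fun t => α (⌈t⌉₊ + 1) t, by simp [hα0], fun t ht => ?_⟩
  set k := ⌈t⌉₊ + 1 with hk
  have htk : t < k := by
    rw [hk]; push_cast; exact (Nat.le_ceil t).trans_lt (lt_add_one _)
  have hmem : Icc (0 : ℝ) k ∈ 𝓝[Ici 0] t :=
    mem_nhdsWithin.2 ⟨Iio k, isOpen_Iio, htk, fun s hs => ⟨hs.2, le_of_lt hs.1⟩⟩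
  have heq : ∀ s ∈ Icc (0 : ℝ) k, α (⌈s⌉₊ + 1) s = α k s := by
    intro s hs
    rcases le_total (⌈s⌉₊ + 1) k with h | h
    · refine huniq _ _ h ⟨hs.1, ?_⟩
      push_cast
      exact (Nat.le_ceil s).trans (by linarith)
    · exact (huniq _ _ h hs).symm
  have h1 : HasDerivWithinAt (fun s => α (⌈s⌉₊ + 1) s) (v (α k t)) (Icc 0 k) t :=
    (hα k t ⟨ht, htk.le⟩).congr heq (heq t ⟨ht, htk.le⟩)
  exact h1.mono_of_mem_nhdsWithin hmem

/-- A form of Nagumo's theorem: a solution of `y' = F (π y)` that starts in a set `K` with metric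
projection `π` stays in `K`, provided that `F` is directed into `K` at the points `π (y t)`.
The squared distance of `y` to `K` has nonpositive upper right derivatives, because at time `t` it is
bounded by the squared distance to the fixed point `π (y t)`, with equality at `t`. -/
theorem mem_of_hasDerivWithinAt_comp_projection {E : Type*} [NormedAddCommGroup E]
    [InnerProductSpace ℝ E] {K : Set E} {π : E → E} (hπc : Continuous π) (hπK : ∀ x, π x ∈ K)
    (hπfix : ∀ x ∈ K, π x = x) (hobt : ∀ x, ∀ z ∈ K, inner ℝ (x - π x) (z - π x) ≤ 0)
    {F : E → E} {y : ℝ → E} {a b : ℝ}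
    (hy : ∀ t ∈ Icc a b, HasDerivWithinAt y (F (π (y t))) (Icc a b) t) (ha : y a ∈ K)
    (htan : ∀ t ∈ Ico a b, ∃ h : ℝ, 0 < h ∧ π (y t) + h • F (π (y t)) ∈ K) :
    ∀ t ∈ Icc a b, y t ∈ K := by
  have hnear : ∀ x, ∀ z ∈ K, ‖x - π x‖ ^ 2 ≤ ‖x - z‖ ^ 2 := by
    intro x z hz
    have h1 := hobt x z hz
    have h2 : x - z = (x - π x) - (z - π x) := by abel
    rw [h2, norm_sub_sq_real (x - π x)]
    nlinarith [sq_nonneg ‖z - π x‖]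
  have hyc : ContinuousOn y (Icc a b) := fun t ht => (hy t ht).continuousWithinAt
  have hle : ∀ ⦃t⦄, t ∈ Icc a b → ‖y t - π (y t)‖ ^ 2 ≤ (0 : ℝ) := by
    refine image_le_of_liminf_slope_right_le_deriv_boundary (B := fun _ => 0) (B' := fun _ => 0)
      ?_ ?_ continuousOn_const (fun t _ => hasDerivWithinAt_const ..) ?_
    · exact ((hyc.sub (hπc.comp_continuousOn hyc)).norm).pow 2
    · simp [hπfix _ ha]
    · intro t ht r hr
      obtain ⟨h, h0, hK⟩ := htan t ht
      have hneg : inner ℝ (y t - π (y t)) (F (π (y t))) ≤ 0 := by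
        have := hobt (y t) _ hK
        rw [add_sub_cancel_left, inner_smul_right] at this
        by_contra! hpos
        exact absurd this (not_le.2 (mul_pos h0 hpos))
      -- compare with the squared distance to the fixed point `π (y t)`
      have hder : HasDerivWithinAt (fun s => ‖y s - π (y t)‖ ^ 2)
          (2 * inner ℝ (y t - π (y t)) (F (π (y t)))) (Ioi t) t := by
        have h1 : HasDerivWithinAt y (F (π (y t))) (Ioi t) t :=
          (hy t (Ico_subset_Icc_self ht)).mono_of_mem_nhdsWithin
            (mem_of_superset (Icc_mem_nhdsGT ht.2) (Icc_subset_Icc_left ht.1))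
        exact (h1.sub_const (π (y t))).norm_sq
      have hev := ((hasDerivWithinAt_iff_tendsto_slope' self_notMem_Ioi).1 hder).eventually_lt_const
        (show 2 * inner ℝ (y t - π (y t)) (F (π (y t))) < r by linarith)
      refine Eventually.frequently ?_
      filter_upwards [hev, self_mem_nhdsWithin] with s hs hts
      refine lt_of_le_of_lt ?_ hs
      rw [slope_def_field, slope_def_field]
      have : 0 < s - t := sub_pos.2 hts
      exact div_le_div_of_nonneg_right (sub_le_sub_right (hnear _ _ (hπK _)) _) this.le
  intro t ht
  have h0 : ‖y t - π (y t)‖ = 0 := by nlinarith [hle ht, norm_nonneg (y t - π (y t))]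
  rw [sub_eq_zero.1 (norm_eq_zero.1 h0)]
  exact hπK _

/-! ### Barycentric coordinates and blocked facets -/

/-- The vertices of a full-dimensional simplex as an affine basis; its coordinates are the
barycentric coordinates of the simplex. -/
noncomputable def simplexBasis {n : ℕ} (s : Affine.Simplex ℝ (Vec n) n) :
    AffineBasis (Fin (n + 1)) ℝ (Vec n) :=
  ⟨s.points, s.independent,
    s.independent.affineSpan_eq_top_iff_card_eq_finrank_add_one.2 (by simp)⟩

theorem mem_simplexBody_iff {n : ℕ} {s : Affine.Simplex ℝ (Vec n) n} {x : Vec n} :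
    x ∈ simplexBody s ↔ ∀ j, 0 ≤ (simplexBasis s).coord j x := by
  have h := (simplexBasis s).convexHull_eq_nonneg_coord
  have h' : simplexBody s = {x | ∀ j, 0 ≤ (simplexBasis s).coord j x} := h
  rw [h']
  rfl

theorem mem_facet_of_coord_eq_zero {n : ℕ} {s : Affine.Simplex ℝ (Vec n) n} {x : Vec n}
    (hx : x ∈ simplexBody s) {j : Fin (n + 1)} (hj : (simplexBasis s).coord j x = 0) :
    x ∈ facet s j := by
  have hsum := (simplexBasis s).linear_combination_coord_eq_self x
  have hone := (simplexBasis s).sum_coord_apply_eq_one x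
  rw [← Finset.sum_erase_add _ _ (Finset.mem_univ j), hj] at hsum hone
  rw [zero_smul, add_zero] at hsum
  rw [add_zero] at hone
  rw [← hsum]
  refine (convex_convexHull ℝ _).sum_mem (fun i _ => mem_simplexBody_iff.1 hx i) hone
    fun i hi => subset_convexHull ℝ _ ⟨i, Finset.ne_of_mem_erase hi, rfl⟩

theorem facet_subset_simplexBody {n : ℕ} (s : Affine.Simplex ℝ (Vec n) n) (j : Fin (n + 1)) :
    facet s j ⊆ simplexBody s :=
  convexHull_mono (image_subset_range _ _)

theorem isCompact_facet {n : ℕ} (s : Affine.Simplex ℝ (Vec n) n) (j : Fin (n + 1)) :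
    IsCompact (facet s j) :=
  (((Set.toFinite {i | i ≠ j}).image s.points).isCompact_convexHull ℝ)

theorem isCompact_simplexBody {n : ℕ} (s : Affine.Simplex ℝ (Vec n) n) :
    IsCompact (simplexBody s) :=
  (finite_range s.points).isCompact_convexHull ℝ

theorem convex_simplexBody {n : ℕ} (s : Affine.Simplex ℝ (Vec n) n) :
    Convex ℝ (simplexBody s) :=
  convex_convexHull ℝ _

theorem continuous_simplexBasis_coord {n : ℕ} (s : Affine.Simplex ℝ (Vec n) n)
    (j : Fin (n + 1)) : Continuous ((simplexBasis s).coord j) :=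
  continuous_barycentric_coord _ _

/-- A vector along which no vanishing barycentric coordinate of `x` decreases points into the
simplex. -/
theorem exists_pos_add_smul_mem_simplexBody {n : ℕ} {s : Affine.Simplex ℝ (Vec n) n}
    {x v : Vec n} (hx : x ∈ simplexBody s)
    (hv : ∀ j, (simplexBasis s).coord j x = 0 → 0 ≤ ((simplexBasis s).coord j).linear v) :
    ∃ h : ℝ, 0 < h ∧ x + h • v ∈ simplexBody s := by
  have hcoord : ∀ j (h : ℝ), (simplexBasis s).coord j (x + h • v) =
      (simplexBasis s).coord j x + h * ((simplexBasis s).coord j).linear v := by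
    intro j h
    have := ((simplexBasis s).coord j).map_vadd x (h • v)
    rw [map_smul, vadd_eq_add, vadd_eq_add, smul_eq_mul] at this
    rw [add_comm x, this, add_comm]
  have hev : ∀ᶠ h in 𝓝[>] (0 : ℝ), ∀ j, 0 ≤ (simplexBasis s).coord j (x + h • v) := by
    refine eventually_all.2 fun j => ?_
    simp only [hcoord]
    rcases (mem_simplexBody_iff.1 hx j).eq_or_lt with h0 | hpos
    · filter_upwards [self_mem_nhdsWithin] with h hh
      rw [← h0, zero_add]
      exact mul_nonneg (le_of_lt hh) (hv j h0.symm)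
    · have hc : Tendsto (fun h : ℝ => (simplexBasis s).coord j x +
          h * ((simplexBasis s).coord j).linear v) (𝓝[>] 0) (𝓝 ((simplexBasis s).coord j x)) := by
        refine Tendsto.mono_left ?_ nhdsWithin_le_nhds
        exact Continuous.tendsto' (by fun_prop) _ _ (by simp)
      filter_upwards [hc.eventually_const_lt hpos] with h hh using hh.le
  obtain ⟨h, hmem, hpos⟩ := (hev.and self_mem_nhdsWithin).exists
  exact ⟨h, hpos, mem_simplexBody_iff.2 hmem⟩

/-- On a blocked facet, the barycentric coordinate that vanishes there does not decrease along the
disturbed affine field: its gradient is a negative multiple of the outward unit normal. -/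
theorem IsBlocked.linear_coord_nonneg {n m : ℕ} {s : Affine.Simplex ℝ (Vec n) n}
    {L : DisturbedAffineSystem n m} {h : Vec n → Vec m} {j : Fin (n + 1)}
    (hb : IsBlocked s L h j) {x : Vec n} (hx : x ∈ simplexBody s)
    (hxj : (simplexBasis s).coord j x = 0) {w : Vec n} (hw : w ∈ L.W) :
    0 ≤ ((simplexBasis s).coord j).linear (L.A x + L.B (h x) + L.a + w) := by
  set ℓ := ((simplexBasis s).coord j).linear with hℓ
  set c : Vec n := (InnerProductSpace.toDual ℝ (Vec n)).symm (LinearMap.toContinuousLinearMap ℓ)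
  have hc : ∀ v, inner ℝ c v = ℓ v := fun v => by
    simp only [c, InnerProductSpace.toDual_symm_apply, LinearMap.coe_toContinuousLinearMap']
  have hdiff : ∀ u v : Vec n, inner ℝ c u - inner ℝ c v =
      (simplexBasis s).coord j u - (simplexBasis s).coord j v := by
    intro u v
    rw [← inner_sub_right, hc, hℓ, ← vsub_eq_sub, AffineMap.linearMap_vsub, vsub_eq_sub]
  have hj1 : (simplexBasis s).coord j (s.points j) = 1 := (simplexBasis s).coord_apply_eq j
  have hi0 : ∀ i, i ≠ j → (simplexBasis s).coord j (s.points i) = 0 := fun i hi =>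
    (simplexBasis s).coord_apply_ne hi.symm
  -- in dimension `0` the coordinate is constantly `1`, contrary to `hxj`
  have hcne : c ≠ 0 := by
    intro h0
    have := hdiff (s.points j) x
    rw [h0, inner_zero_left, inner_zero_left, hj1, hxj] at this
    norm_num at this
  have hcpos : 0 < ‖c‖ := norm_pos_iff.2 hcne
  have hν : ∀ v : Vec n, inner ℝ (-(‖c‖⁻¹ • c)) v = -(‖c‖⁻¹ * inner ℝ c v) := fun v => by
    rw [inner_neg_left, real_inner_smul_left]
  have hnormal : IsOutwardNormal s j (-(‖c‖⁻¹ • c)) := by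
    refine ⟨?_, fun i k hi hk => ?_, fun i hi => ?_⟩
    · rw [norm_neg, norm_smul, norm_inv, norm_norm, inv_mul_cancel₀ hcpos.ne']
    · have := hdiff (s.points i) (s.points k)
      rw [hi0 i hi, hi0 k hk, sub_self, sub_eq_zero] at this
      rw [hν, hν, this]
    · have := hdiff (s.points j) (s.points i)
      rw [hj1, hi0 i hi] at this
      rw [hν, hν, neg_lt_neg_iff]
      exact mul_lt_mul_of_pos_left (by linarith) (inv_pos.2 hcpos)
  have hblock := hb _ hnormal x (mem_facet_of_coord_eq_zero hx hxj)
  have hsup : inner ℝ (-(‖c‖⁻¹ • c)) w ≤ sSup ((fun w => inner ℝ (-(‖c‖⁻¹ • c)) w) '' L.W) := by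
    refine le_csSup ?_ ⟨w, hw, rfl⟩
    exact (L.W_compact.image (by fun_prop)).bddAbove
  have hsum : inner ℝ (-(‖c‖⁻¹ • c)) (L.A x + L.B (h x) + L.a + w) ≤ 0 := by
    rw [inner_add_right]
    linarith
  rw [hν, neg_nonpos] at hsum
  rw [← hc]
  exact nonneg_of_mul_nonneg_right hsum (inv_pos.2 hcpos)

/-! ### Closed-loop solutions in a simplex -/

theorem ControlSystem.exists_lipschitzOnWith_field {n m : ℕ} (sys : ControlSystem n m)
    {K : Set (Vec n)} (hK : IsCompact K) (hKc : Convex ℝ K) (hKX : K ⊆ sys.X)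
    {h : Vec n → Vec m} (hh : ContDiff ℝ 1 h) :
    ∃ C, LipschitzOnWith C (sys.field h) K := by
  have hf : ContDiffOn ℝ 1 sys.f K := (sys.f_contDiff.mono hKX).of_le (by norm_num)
  have hg : ContDiffOn ℝ 1 sys.g K := sys.g_contDiff.mono hKX
  exact (hf.add (hg.clm_apply hh.contDiffOn)).exists_lipschitzOnWith one_ne_zero hKc hK

theorem ControlSystem.continuousOn_field {n m : ℕ} (sys : ControlSystem n m)
    {K : Set (Vec n)} (hKX : K ⊆ sys.X) {h : Vec n → Vec m} (hh : ContinuousOn h K) :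
    ContinuousOn (sys.field h) K :=
  (sys.f_contDiff.continuousOn.mono hKX).add ((sys.g_contDiff.continuousOn.mono hKX).clm_apply hh)

theorem SolvesExitProblem.contDiff {n m : ℕ} {U : Set (Vec m)}
    {s : Affine.Simplex ℝ (Vec n) n} {J : Set (Fin (n + 1))} {L : DisturbedAffineSystem n m}
    {h : Vec n → Vec m} (hsol : SolvesExitProblem U s J L h) : ContDiff ℝ 1 h := by
  obtain ⟨K, k, hK⟩ := hsol.affine
  rw [show h = fun x => K x + k from funext hK]
  fun_prop

/-- No closed-loop solution stays in the simplex forever: in the simplex it is a trajectory of the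
disturbed affine system, the disturbance being the linearization error along the solution. -/
theorem SolvesExitProblem.not_forall_mem {n m : ℕ} {sys : ControlSystem n m}
    {s : Affine.Simplex ℝ (Vec n) n} {J : Set (Fin (n + 1))} {L : DisturbedAffineSystem n m}
    {h : Vec n → Vec m} (hsol : SolvesExitProblem sys.U s J L h) (hX : simplexBody s ⊆ sys.X)
    (hL : ∀ x ∈ simplexBody s, ∀ u ∈ sys.U, sys.f x + sys.g x u - L.A x - L.B u - L.a ∈ L.W)
    {x : ℝ → Vec n}
    (hx : ∀ t ∈ Ici (0 : ℝ), HasDerivWithinAt x (sys.field h (x t)) (Ici 0) t) :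
    ¬ ∀ t ∈ Ici (0 : ℝ), x t ∈ simplexBody s := by
  intro hmem
  have hxc : ContinuousOn x (Ici 0) := fun t ht => (hx t ht).continuousWithinAt
  have hhc : Continuous h := hsol.contDiff.continuous
  have htraj : IsDisturbedTrajectory L h x := by
    refine ⟨fun t => sys.field h (x t) - L.A (x t) - L.B (h (x t)) - L.a, ?_, ?_, ?_⟩
    · have h1 : ContinuousOn (fun t => sys.field h (x t)) (Ici 0) :=
        (sys.continuousOn_field hX hhc.continuousOn).comp hxc hmem
      fun_prop
    · exact fun t ht => hL _ (hmem t ht) _ (hsol.mapsTo (hmem t ht))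
    · intro t ht
      convert hx t ht using 1
      module
  obtain ⟨T, hT, ε, hε, -, hout⟩ := hsol.exits x htraj (hmem 0 self_mem_Ici)
  exact hout (T + ε / 2) ⟨by linarith, by linarith⟩ (hmem _ (by simp only [mem_Ici]; linarith))

/-- From each point of the simplex some closed-loop solution reaches a facet in `J` without leaving
the simplex. The solution is constructed for the field precomposed with the projection onto the
simplex. As long as it avoids the facets in `J`, only blocked facets can be active, and it stays in
the simplex; it cannot do so forever. -/
theorem SolvesExitProblem.exists_solution_reaching_facet {n m : ℕ} {sys : ControlSystem n m}
    {s : Affine.Simplex ℝ (Vec n) n} {J : Set (Fin (n + 1))} {L : DisturbedAffineSystem n m}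
    {h : Vec n → Vec m} (hsol : SolvesExitProblem sys.U s J L h) (hX : simplexBody s ⊆ sys.X)
    (hL : ∀ x ∈ simplexBody s, ∀ u ∈ sys.U, sys.f x + sys.g x u - L.A x - L.B u - L.a ∈ L.W)
    {x₀ : Vec n} (hx₀ : x₀ ∈ simplexBody s) :
    ∃ (T : ℝ) (y : ℝ → Vec n), 0 ≤ T ∧ y 0 = x₀ ∧
      (∀ t ∈ Icc 0 T, y t ∈ simplexBody s ∧
        HasDerivWithinAt y (sys.field h (y t)) (Icc 0 T) t) ∧
      ∃ j ∈ J, y T ∈ facet s j := by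
  have hScomp := isCompact_simplexBody s
  obtain ⟨C, hC⟩ := sys.exists_lipschitzOnWith_field hScomp (convex_simplexBody s) hX
    hsol.contDiff
  obtain ⟨π, hπ, hπS, hπfix, hobt⟩ :=
    exists_convex_projection ⟨x₀, hx₀⟩ hScomp.isComplete (convex_simplexBody s)
  have hlip : LipschitzWith C (fun x => sys.field h (π x)) := by
    rw [← lipschitzOnWith_univ]
    simpa [Function.comp_def] using
      hC.comp (hπ.lipschitzOnWith (s := univ)) (fun x _ => hπS x)
  obtain ⟨B, hB⟩ := hScomp.exists_bound_of_continuousOn hC.continuousOn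
  obtain ⟨y, hy0, hy⟩ := hlip.exists_forall_hasDerivWithinAt_Ici (L := B.toNNReal)
    (fun x => (hB _ (hπS x)).trans (Real.le_coe_toNNReal B)) x₀
  have hyc : ContinuousOn y (Ici 0) := fun t ht => (hy t ht).continuousWithinAt
  by_contra hno
  have havoid : ∀ T : ℝ, 0 ≤ T → (∀ t ∈ Icc 0 T, y t ∈ simplexBody s) →
      ∀ j ∈ J, y T ∉ facet s j := by
    intro T hT hmem j hj hyj
    refine hno ⟨T, y, hT, hy0, fun t ht => ⟨hmem t ht, ?_⟩, j, hj, hyj⟩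
    have := (hy t ht.1).mono (Icc_subset_Ici_self : Icc 0 T ⊆ Ici 0)
    rwa [hπfix _ (hmem t ht)] at this
  have hstay : ∀ t ∈ Ici (0 : ℝ), y t ∈ simplexBody s := by
    by_contra! hne
    set N : Set ℝ := {t | 0 ≤ t ∧ y t ∉ simplexBody s} with hN
    have hNne : N.Nonempty := hne
    have hNbdd : BddBelow N := ⟨0, fun t ht => ht.1⟩
    set T := sInf N with hT
    have hT0 : 0 ≤ T := le_csInf hNne fun t ht => ht.1
    have hbefore : ∀ t ∈ Ico 0 T, y t ∈ simplexBody s := by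
      intro t ht
      by_contra hnot
      exact (not_le.2 ht.2) (csInf_le hNbdd ⟨ht.1, hnot⟩)
    have hupto : ∀ t ∈ Icc 0 T, y t ∈ simplexBody s := by
      rcases hT0.eq_or_lt with h0 | hpos
      · intro t ht
        rw [← h0, Icc_self, mem_singleton_iff] at ht
        rw [ht, hy0]
        exact hx₀
      · have hcl : IsClosed (Ici 0 ∩ y ⁻¹' simplexBody s) :=
          hyc.preimage_isClosed_of_isClosed isClosed_Ici hScomp.isClosed
        have : closure (Ico 0 T) ⊆ Ici 0 ∩ y ⁻¹' simplexBody s :=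
          closure_minimal (fun t ht => ⟨ht.1, hbefore t ht⟩) hcl
        rw [closure_Ico hpos.ne] at this
        exact fun t ht => (this ht).2
    have hyT : y T ∈ simplexBody s := hupto T ⟨hT0, le_rfl⟩
    -- shortly after `T`, only blocked facets are active at the projected point
    have hactive : ∀ᶠ t in 𝓝[≥] T, ∀ j ∈ J, (simplexBasis s).coord j (π (y t)) ≠ 0 := by
      refine eventually_all.2 fun j => ?_
      by_cases hj : j ∈ J
      swap
      · exact Eventually.of_forall fun t hj' => absurd hj' hj
      have hc : ContinuousWithinAt (fun t => (simplexBasis s).coord j (π (y t))) (Ici T) T :=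
        ((continuous_simplexBasis_coord s j).comp hπ.continuous).continuousAt.comp_continuousWithinAt
          ((hyc T hT0).mono (Ici_subset_Ici.2 hT0))
      have hne0 : (simplexBasis s).coord j (π (y T)) ≠ 0 := by
        rw [hπfix _ hyT]
        exact fun h0 => havoid T hT0 hupto j hj (mem_facet_of_coord_eq_zero hyT h0)
      filter_upwards [hc.eventually_ne hne0] with t ht _ using ht
    obtain ⟨b, hTb, hb⟩ := mem_nhdsGE_iff_exists_Ico_subset.1 hactive
    have hafter := mem_of_hasDerivWithinAt_comp_projection hπ.continuous hπS hπfix hobt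
      (F := sys.field h) (y := y) (a := T) (b := b)
      (fun t ht => (hy t (hT0.trans ht.1)).mono
        (Icc_subset_Ici_self.trans (Ici_subset_Ici.2 hT0))) hyT (by
        intro t ht
        refine exists_pos_add_smul_mem_simplexBody (hπS _) fun j hj0 => ?_
        have hjJ : j ∉ J := fun hj => hb ht j hj hj0
        have hw := hL _ (hπS (y t)) _ (hsol.mapsTo (hπS (y t)))
        convert (hsol.blocked j hjJ).linear_coord_nonneg (hπS _) hj0 hw using 2
        simp only [ControlSystem.field]
        abel)
    obtain ⟨t, ht, htb⟩ := exists_lt_of_csInf_lt hNne (show sInf N < b from hTb)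
    exact ht.2 (hafter t ⟨csInf_le hNbdd ht, htb.le⟩)
  refine hsol.not_forall_mem hX hL (x := y) (fun t ht => ?_) hstay
  have := hy t ht
  rwa [hπfix _ (hstay t ht)] at this

/-! ### Concatenation of solutions and continuation of executions -/

/-- A solution on `[a, b)` that is differentiable at `b` satisfies the equation at `b` too, because
its derivatives converge there. -/
theorem hasDerivWithinAt_of_continuousOn_field {E : Type*} [NormedAddCommGroup E]
    [NormedSpace ℝ E] {x : ℝ → E} {F : E → E} {D : Set E} {a b : ℝ} (hF : ContinuousOn F D)
    (hdiff : DifferentiableOn ℝ x (Icc a b)) (hb : x b ∈ D)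
    (hx : ∀ s ∈ Ico a b, x s ∈ D ∧ HasDerivWithinAt x (F (x s)) (Icc a b) s) :
    ∀ s ∈ Icc a b, x s ∈ D ∧ HasDerivWithinAt x (F (x s)) (Icc a b) s := by
  intro s hs
  rcases hs.2.lt_or_eq with hsb | rfl
  · exact hx s ⟨hs.1, hsb⟩
  refine ⟨hb, ?_⟩
  rcases hs.1.eq_or_lt with rfl | has
  · rw [Icc_self]
    exact HasFDerivWithinAt.of_subsingleton subsingleton_singleton
  have hmem : Ioo a s ∈ 𝓝[<] s := Ioo_mem_nhdsLT has
  have hder : ∀ r ∈ Ioo a s, HasDerivAt x (F (x r)) r := fun r hr =>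
    (hx r ⟨hr.1.le, hr.2⟩).2.hasDerivAt (Icc_mem_nhds hr.1 hr.2)
  have hlim : Tendsto (fun r => F (x r)) (𝓝[<] s) (𝓝 (F (x s))) := by
    have hxs : Tendsto x (𝓝[<] s) (𝓝[D] (x s)) := by
      refine tendsto_nhdsWithin_iff.2 ⟨?_, ?_⟩
      · have h1 : ContinuousWithinAt x (Ioo a s) s :=
          (hdiff s hs).continuousWithinAt.mono Ioo_subset_Icc_self
        rwa [ContinuousWithinAt, nhdsWithin_Ioo_eq_nhdsLT has] at h1
      · filter_upwards [hmem] with r hr using (hx r ⟨hr.1.le, hr.2⟩).1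
    exact (hF _ hb).tendsto.comp hxs
  refine (hasDerivWithinAt_Iic_of_tendsto_deriv (s := Ioo a s)
    (fun r hr => (hder r hr).differentiableAt.differentiableWithinAt)
    ((hdiff s hs).continuousWithinAt.mono Ioo_subset_Icc_self) hmem
    (hlim.congr' ?_)).mono Icc_subset_Iic_self
  filter_upwards [hmem] with r hr using (hder r hr).deriv.symm

/-- Concatenation, at time `b`, of a solution on `[a, b]` and a solution on `J ⊆ [0, +∞)` shifted by
`b`. -/
theorem hasDerivWithinAt_concat {E : Type*} [NormedAddCommGroup E] [NormedSpace ℝ E]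
    {x y : ℝ → E} {F : E → E} {D : Set E} {a b : ℝ} {I J : Set ℝ}
    (hx : ∀ s ∈ Icc a b, x s ∈ D ∧ HasDerivWithinAt x (F (x s)) (Icc a b) s)
    (hJ : IsClosed J) (hJ0 : J ⊆ Ici 0)
    (hy : ∀ s ∈ J, y s ∈ D ∧ HasDerivWithinAt y (F (y s)) J s) (hxy : y 0 = x b)
    (hI : I ⊆ Icc a b ∪ (fun s => s - b) ⁻¹' J) :
    ∀ s ∈ I, (if s ≤ b then x s else y (s - b)) ∈ D ∧
      HasDerivWithinAt (fun s => if s ≤ b then x s else y (s - b))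
        (F (if s ≤ b then x s else y (s - b))) I s := by
  set z : ℝ → E := fun s => if s ≤ b then x s else y (s - b) with hz
  have hzx : EqOn z x (Icc a b) := fun s hs => if_pos hs.2
  have hzy : EqOn z (fun s => y (s - b)) ((fun s => s - b) ⁻¹' J) := by
    intro s hs
    have h0 : 0 ≤ s - b := hJ0 hs
    by_cases hsb : s ≤ b
    · have : s = b := by linarith
      simp only [hz]
      rw [if_pos hsb, this, sub_self, hxy]
    · exact if_neg hsb
  have hJ' : IsClosed ((fun s => s - b) ⁻¹' J) := hJ.preimage (by fun_prop)
  intro s hs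
  change z s ∈ D ∧ HasDerivWithinAt z (F (z s)) I s
  refine ⟨?_, HasDerivWithinAt.mono ((?_ : HasDerivWithinAt z _ _ s).union ?_) hI⟩
  · rcases hI hs with h | h
    · rw [hzx h]
      exact (hx s h).1
    · rw [hzy h]
      exact (hy _ h).1
  · by_cases h : s ∈ Icc a b
    · rw [hzx h]
      exact (hx s h).2.congr hzx (hzx h)
    · exact HasFDerivWithinAt.of_notMem_closure (by rwa [isClosed_Icc.closure_eq])
  · by_cases h : s ∈ (fun s => s - b) ⁻¹' J
    · rw [hzy h]
      refine HasDerivWithinAt.congr ?_ hzy (hzy h)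
      have := (hy _ h).2.scomp s ((hasDerivWithinAt_id s _).sub_const b) (mapsTo_preimage _ _)
      simpa [Function.comp_def] using this
    · exact HasFDerivWithinAt.of_notMem_closure (by rwa [hJ'.closure_eq])

namespace HybridPath

variable {n : ℕ} {M : Type*}

theorem τ_of_not_isUnboundedAt {e : HybridPath n M} {i : ℕ} (h : ¬ e.IsUnboundedAt i) :
    e.τ i = Icc (e.t i) (e.t (i + 1)) := by
  ext s
  simp [τ, h]

theorem τOpen_of_not_isUnboundedAt {e : HybridPath n M} {i : ℕ} (h : ¬ e.IsUnboundedAt i) :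
    e.τOpen i = Ico (e.t i) (e.t (i + 1)) := by
  ext s
  simp [τOpen, h]

theorem τOpen_subset_τ (e : HybridPath n M) (i : ℕ) : e.τOpen i ⊆ e.τ i :=
  fun _ hs => ⟨hs.1, fun h => (hs.2 h).le⟩

theorem Extends.trans {e₁ e₂ e₃ : HybridPath n M} (h₃₂ : e₃.Extends e₂) (h₂₁ : e₂.Extends e₁) :
    e₃.Extends e₁ := by
  refine ⟨h₂₁.1.trans h₃₂.1, fun i hi => ?_⟩
  obtain ⟨ht, hq, hτ, hx⟩ := h₂₁.2 i hi
  obtain ⟨ht', hq', hτ', hx'⟩ := h₃₂.2 i (hi.trans h₂₁.1)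
  exact ⟨ht'.trans ht, hq'.trans hq, hτ.trans hτ', fun s hs => (hx' (hτ hs)).trans (hx hs)⟩

end HybridPath

namespace IsExecution

variable {n m : ℕ} {M : Type*} {sys : ControlSystem n m} {C : HybridControllerData n m M}
  {e : HybridPath n M}

theorem initial_mem_domain (hC : IsHybridController sys C) (he : IsExecution sys C e) {i : ℕ}
    (hi : (i : ℕ∞) ≤ e.N) : e.x i (e.t i) ∈ C.D (e.q i) := by
  cases i with
  | zero => exact he.start_mem.2
  | succ k =>
    have hk : (k : ℕ∞) < e.N := lt_of_lt_of_le (by exact_mod_cast k.lt_succ_self) hi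
    obtain ⟨hE, -, hG⟩ := he.jump k hk
    exact (hC.guard_subset _ hE hG).2

/-- On a bounded interval of an execution, the flow condition extends to the right end point. -/
theorem forall_mem_τ_hasDerivWithinAt (hC : IsHybridController sys C) (he : IsExecution sys C e)
    {i : ℕ} (hi : (i : ℕ∞) ≤ e.N) (hu : ¬ e.IsUnboundedAt i) :
    ∀ s ∈ Icc (e.t i) (e.t (i + 1)), e.x i s ∈ C.D (e.q i) ∧
      HasDerivWithinAt (e.x i) (sys.field (C.h (e.q i)) (e.x i s))
        (Icc (e.t i) (e.t (i + 1))) s := by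
  have hq := he.modes i hi
  have hdiff := he.differentiable i hi
  have hflow := he.flow i hi
  rw [HybridPath.τ_of_not_isUnboundedAt hu] at hdiff hflow
  rw [HybridPath.τOpen_of_not_isUnboundedAt hu] at hflow
  have hle := he.times i hi hu
  obtain ⟨K, hK⟩ := hC.control_lipschitz _ hq
  refine hasDerivWithinAt_of_continuousOn_field
    (sys.continuousOn_field (hC.domain_subset _ hq) hK.continuousOn) hdiff ?_ hflow
  rcases hle.eq_or_lt with h | h
  · rw [← h]
    exact he.initial_mem_domain hC hi
  · have hcl := hdiff.continuousOn.preimage_isClosed_of_isClosed isClosed_Icc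
      (hC.domain_compact _ hq).isClosed
    have hsub : Ico (e.t i) (e.t (i + 1)) ⊆
        Icc (e.t i) (e.t (i + 1)) ∩ e.x i ⁻¹' C.D (e.q i) :=
      fun s hs => ⟨Ico_subset_Icc_self hs, (hflow s hs).1⟩
    replace hsub := closure_minimal hsub hcl
    rw [closure_Ico h.ne] at hsub
    exact (hsub ⟨hle, le_rfl⟩).2

/-- The last interval of a finite execution can be prolonged along a closed-loop solution `y` that
stays in the domain of the last mode, for all times if `unb` holds and up to time `T` otherwise. -/
theorem exists_prolongation (hC : IsHybridController sys C) (he : IsExecution sys C e) {N : ℕ}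
    (hN : e.N = N) (hu : ¬ e.unbounded) (unb : Prop) {T : ℝ} (hT : 0 ≤ T) {y : ℝ → Vec n}
    (hy0 : y 0 = e.x N (e.t (N + 1)))
    (hy : ∀ s ∈ {s : ℝ | 0 ≤ s ∧ (¬ unb → s ≤ T)}, y s ∈ C.D (e.q N) ∧
      HasDerivWithinAt y (sys.field (C.h (e.q N)) (y s)) {s : ℝ | 0 ≤ s ∧ (¬ unb → s ≤ T)} s) :
    ∃ e' : HybridPath n M, IsExecution sys C e' ∧ e'.Extends e ∧ e'.N = N ∧
      e'.unbounded = unb ∧ e'.q N = e.q N ∧ e'.x N (e'.t (N + 1)) = y T := by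
  classical
  set b := e.t (N + 1) with hb
  set z : ℝ → Vec n := fun s => if s ≤ b then e.x N s else y (s - b) with hz
  have hNN : (N : ℕ∞) ≤ e.N := hN.ge
  have hnu : ∀ i, ¬ e.IsUnboundedAt i := fun i h => hu h.2
  have hab : e.t N ≤ b := he.times N hNN (hnu N)
  let e' : HybridPath n M :=
    { N := N
      unbounded := unb
      t := Function.update e.t (N + 1) (b + T)
      q := e.q
      x := Function.update e.x N z }
  have ht : ∀ i ≤ N, e'.t i = e.t i := fun i hi =>
    Function.update_of_ne (by omega) _ _
  have htN : e'.t (N + 1) = b + T := Function.update_self _ _ _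
  have hx : ∀ i, i ≠ N → e'.x i = e.x i := fun i hi => Function.update_of_ne hi _ _
  have hxN : e'.x N = z := Function.update_self _ _ _
  have hlt : ∀ i < N, ¬ e'.IsUnboundedAt i := by
    rintro i hi ⟨h, -⟩
    have : i = N := Nat.cast_injective (R := ℕ∞) h
    omega
  have hunbN : e'.IsUnboundedAt N ↔ unb := ⟨fun h => h.2, fun h => ⟨rfl, h⟩⟩
  have hτ : ∀ i < N, e'.τ i = e.τ i := fun i hi => by
    rw [HybridPath.τ_of_not_isUnboundedAt (hlt i hi), HybridPath.τ_of_not_isUnboundedAt (hnu i),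
      ht i hi.le, ht (i + 1) hi]
  have hτo : ∀ i < N, e'.τOpen i = e.τOpen i := fun i hi => by
    rw [HybridPath.τOpen_of_not_isUnboundedAt (hlt i hi),
      HybridPath.τOpen_of_not_isUnboundedAt (hnu i), ht i hi.le, ht (i + 1) hi]
  have hτN : e'.τ N = {s | e.t N ≤ s ∧ (¬ unb → s ≤ b + T)} := by
    ext s
    simp only [HybridPath.τ, mem_ofPred_eq, hunbN, ht N le_rfl, htN]
  have hsol : ∀ s ∈ e'.τ N, z s ∈ C.D (e.q N) ∧
      HasDerivWithinAt z (sys.field (C.h (e.q N)) (z s)) (e'.τ N) s := by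
    refine hasDerivWithinAt_concat (D := C.D (e.q N))
      (he.forall_mem_τ_hasDerivWithinAt hC hNN (hnu N)) ?_ (fun s hs => hs.1) hy hy0 ?_
    · by_cases hunb : unb
      · simpa [hunb, Ici] using isClosed_Ici (a := (0 : ℝ))
      · simpa [hunb, Icc] using isClosed_Icc (a := (0 : ℝ)) (b := T)
    · rw [hτN]
      rintro s ⟨hs1, hs2⟩
      rcases le_total s b with h | h
      · exact Or.inl ⟨hs1, h⟩
      · exact Or.inr ⟨sub_nonneg.2 h, fun hn => by linarith [hs2 hn]⟩
  have hcast : ∀ {i : ℕ}, (i : ℕ∞) ≤ e'.N → (i : ℕ∞) ≤ e.N := fun h => h.trans hN.ge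
  have hcases : ∀ {i : ℕ}, (i : ℕ∞) ≤ e'.N → i < N ∨ i = N := fun {i} h =>
    ((Nat.cast_le (α := ℕ∞)).1 h).lt_or_eq
  have hqN := he.modes N hNN
  have hstart : ∀ i ≤ N, e'.x i (e'.t i) = e.x i (e.t i) := by
    intro i hi
    rw [ht i hi]
    rcases hi.lt_or_eq with h | rfl
    · rw [hx i h.ne]
    · rw [hxN]
      exact if_pos hab
  refine ⟨e', ?_, ?_, rfl, rfl, rfl, ?_⟩
  · refine ⟨?_, ?_, ?_, fun i hi => he.modes i (hcast hi), ?_, ?_, ?_, ?_⟩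
    · rw [ht 0 N.zero_le, he.start_time]
    · rw [hstart 0 N.zero_le]
      exact he.start_mem
    · intro i hi _
      rcases hcases hi with h | rfl
      · rw [ht i h.le, ht (i + 1) h]
        exact he.times i (hcast hi) (hnu i)
      · rw [ht i le_rfl, htN]
        linarith
    · intro i hi
      rcases hcases hi with h | rfl
      · rw [hx i h.ne, hτ i h]
        exact he.state_mem i (hcast hi)
      · rw [hxN]
        exact fun s hs => hC.domain_subset _ hqN (hsol s hs).1
    · intro i hi
      rcases hcases hi with h | rfl
      · rw [hx i h.ne, hτ i h]
        exact he.differentiable i (hcast hi)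
      · rw [hxN]
        exact fun s hs => (hsol s hs).2.differentiableWithinAt
    · intro i hi
      rcases hcases hi with h | rfl
      · rw [hx i h.ne, hτ i h, hτo i h]
        exact he.flow i (hcast hi)
      · rw [hxN]
        exact fun s hs => hsol s (HybridPath.τOpen_subset_τ _ _ hs)
    · intro i hi
      have hiN : i < N := (Nat.cast_lt (α := ℕ∞)).1 hi
      have hi' : (i : ℕ∞) < e.N := hi.trans_le hN.ge
      rw [hstart (i + 1) hiN, hx i hiN.ne, ht (i + 1) hiN]
      exact he.jump i hi'
  · refine ⟨hN.le, fun i hi => ?_⟩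
    have hi' : (i : ℕ∞) ≤ e'.N := hi.trans hN.le
    rcases hcases hi' with h | rfl
    · exact ⟨ht i h.le, rfl, (hτ i h).ge, by rw [hx i h.ne]; exact fun s _ => rfl⟩
    · refine ⟨ht i le_rfl, rfl, ?_, ?_⟩
      · rw [hτN, HybridPath.τ_of_not_isUnboundedAt (hnu i)]
        exact fun s hs => ⟨hs.1, fun _ => by linarith [hs.2]⟩
      · rw [hxN, HybridPath.τ_of_not_isUnboundedAt (hnu i)]
        exact fun s hs => if_pos hs.2
  · rw [hxN, htN]
    simp only [hz]
    split_ifs with h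
    · have : T = 0 := by linarith
      rw [this, add_zero, hy0]
    · rw [add_sub_cancel_left]

/-- A finite execution that ends in a guard can be continued by a transition into an interval of
length zero. -/
theorem exists_append (hC : IsHybridController sys C) (he : IsExecution sys C e) {N : ℕ}
    (hN : e.N = N) (hu : ¬ e.unbounded) {q' : M} (hE : (e.q N, q') ∈ C.E)
    (hG : e.x N (e.t (N + 1)) ∈ C.G (e.q N, q')) :
    ∃ e' : HybridPath n M, IsExecution sys C e' ∧ e'.Extends e ∧ e'.N = (N + 1 : ℕ) ∧
      ¬ e'.unbounded ∧ e'.q (N + 1) = q' := by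
  classical
  set p := e.x N (e.t (N + 1)) with hp
  have hnu : ∀ i, ¬ e.IsUnboundedAt i := fun i h => hu h.2
  let e' : HybridPath n M :=
    { N := (N + 1 : ℕ)
      unbounded := False
      t := Function.update e.t (N + 2) (e.t (N + 1))
      q := Function.update e.q (N + 1) q'
      x := Function.update e.x (N + 1) fun _ => p }
  have hnu' : ∀ i, ¬ e'.IsUnboundedAt i := fun i h => h.2
  have ht : ∀ i ≤ N + 1, e'.t i = e.t i := fun i hi => Function.update_of_ne (by omega) _ _
  have htN : e'.t (N + 2) = e.t (N + 1) := Function.update_self _ _ _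
  have hq : ∀ i ≤ N, e'.q i = e.q i := fun i hi => Function.update_of_ne (by omega) _ _
  have hqN : e'.q (N + 1) = q' := Function.update_self _ _ _
  have hx : ∀ i ≤ N, e'.x i = e.x i := fun i hi => Function.update_of_ne (by omega) _ _
  have hxN : e'.x (N + 1) = fun _ => p := Function.update_self _ _ _
  have hτ : ∀ i ≤ N, e'.τ i = e.τ i := fun i hi => by
    rw [HybridPath.τ_of_not_isUnboundedAt (hnu' i), HybridPath.τ_of_not_isUnboundedAt (hnu i),
      ht i (by omega), ht (i + 1) (by omega)]
  have hτo : ∀ i ≤ N, e'.τOpen i = e.τOpen i := fun i hi => by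
    rw [HybridPath.τOpen_of_not_isUnboundedAt (hnu' i),
      HybridPath.τOpen_of_not_isUnboundedAt (hnu i), ht i (by omega), ht (i + 1) (by omega)]
  have hcast : ∀ {i : ℕ}, i ≤ N → (i : ℕ∞) ≤ e.N := fun h => by rw [hN]; exact_mod_cast h
  have hcases : ∀ {i : ℕ}, (i : ℕ∞) ≤ e'.N → i ≤ N ∨ i = N + 1 := fun {i} h =>
    Nat.le_add_one_iff.1 ((Nat.cast_le (α := ℕ∞)).1 h)
  have hguard := hC.guard_subset _ hE hG
  have hedge := hC.edges hE
  refine ⟨e', ⟨?_, ?_, ?_, ?_, ?_, ?_, ?_, ?_⟩, ⟨?_, ?_⟩, rfl, id, hqN⟩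
  · rw [ht 0 (by omega), he.start_time]
  · rw [hx 0 N.zero_le, ht 0 (by omega), hq 0 N.zero_le]
    exact he.start_mem
  · intro i hi _
    rcases hcases hi with h | rfl
    · rw [ht i (by omega), ht (i + 1) (by omega)]
      exact he.times i (hcast h) (hnu i)
    · rw [ht _ le_rfl, htN]
  · intro i hi
    rcases hcases hi with h | rfl
    · rw [hq i h]
      exact he.modes i (hcast h)
    · rw [hqN]
      exact hedge.2
  · intro i hi
    rcases hcases hi with h | rfl
    · rw [hx i h, hτ i h]
      exact he.state_mem i (hcast h)
    · rw [hxN]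
      exact fun _ _ => hC.domain_subset _ hedge.2 hguard.2
  · intro i hi
    rcases hcases hi with h | rfl
    · rw [hx i h, hτ i h]
      exact he.differentiable i (hcast h)
    · rw [hxN]
      exact differentiableOn_const _
  · intro i hi
    rcases hcases hi with h | rfl
    · rw [hx i h, hτ i h, hτo i h, hq i h]
      exact he.flow i (hcast h)
    · rw [HybridPath.τOpen_of_not_isUnboundedAt (hnu' _), ht _ le_rfl, htN, Ico_self]
      exact fun s hs => hs.elim
  · intro i hi
    have hi' : i < N + 1 := (Nat.cast_lt (α := ℕ∞)).1 hi
    rcases (Nat.lt_succ_iff.1 hi').lt_or_eq with h | rfl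
    · rw [hq i h.le, hq (i + 1) h, hx i h.le, hx (i + 1) h, ht (i + 1) (by omega)]
      exact he.jump i (by rw [hN]; exact_mod_cast h)
    · rw [hq i le_rfl, hqN, hx i le_rfl, hxN, ht (i + 1) le_rfl]
      exact ⟨hE, rfl, hG⟩
  · rw [hN]
    exact (Nat.cast_le (α := ℕ∞)).2 N.le_succ
  · intro i hi
    have h : i ≤ N := by rw [hN] at hi; exact_mod_cast hi
    exact ⟨ht i (by omega), hq i h, (hτ i h).ge, by rw [hx i h]; exact fun _ _ => rfl⟩

end IsExecution

/-! ### The invariant of the algorithm -/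

/-- The properties of the controller under construction that the algorithm preserves and that imply
the conclusion. The field `exit_simplex` forgets the stage at which the simplex `S p` was added: it
keeps only that the exit problem was solved for some set `J` of facets, each of which lies in the
guard of an edge that leaves the mode `some p`. The field `rank` records that every edge leads from
a later to an earlier stage, hence that the graph of modes has no cycle. -/
structure IsSynthesized {n m : ℕ} {P : Type*} (sys : ControlSystem n m)
    (S : P → Affine.Simplex ℝ (Vec n) n) (L : P → DisturbedAffineSystem n m)
    (C : HybridControllerData n m (Option P)) : Prop where
  target_mem : none ∈ C.Q
  domain_target : C.D none = sys.XT
  control_target : SolvesInvarianceProblem sys (C.h none)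
  domain_simplex : ∀ p, some p ∈ C.Q → C.D (some p) = simplexBody (S p)
  exit_simplex : ∀ p, some p ∈ C.Q → ∃ J, SolvesExitProblem sys.U (S p) J (L p) (C.h (some p)) ∧
    ∀ j ∈ J, ∃ q', (some p, q') ∈ C.E ∧ facet (S p) j ⊆ C.G (some p, q')
  edges : C.E ⊆ C.Q ×ˢ C.Q
  guard_subset : ∀ e ∈ C.E, C.G e ⊆ C.D e.1 ∩ C.D e.2
  guard_compact : ∀ e ∈ C.E, IsCompact (C.G e)
  rank : ∃ r : Option P → ℕ, ∀ e ∈ C.E, r e.2 < r e.1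

section Algorithm

variable {n m : ℕ} {P : Type*} {sys : ControlSystem n m}
  {S : P → Affine.Simplex ℝ (Vec n) n} {PT : Set P} {L : P → DisturbedAffineSystem n m}
  {C : HybridControllerData n m (Option P)}

theorem AlgInit.isSynthesized {s : AlgState n m P} (h : AlgInit sys PT s) :
    IsSynthesized sys S L s.C where
  target_mem := by rw [h.modes]; rfl
  domain_target := h.domain
  control_target := h.control
  domain_simplex p hp := by simp [h.modes] at hp
  exit_simplex p hp := by simp [h.modes] at hp
  edges := by simp [h.edges]
  guard_subset := by simp [h.edges]
  guard_compact := by simp [h.edges]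
  rank := ⟨fun _ => 0, by simp [h.edges]⟩

/-- One iteration preserves the invariant. The new edges go from new modes to old ones, so that the
rank extends by giving the new modes a rank above all old ones. -/
theorem AlgStep.isSynthesized [Finite P] {s s' : AlgState n m P}
    (hPT : ∀ p ∈ PT, simplexBody (S p) ⊆ sys.XT) (h : AlgStep sys S PT L s s')
    (hsub : PT ⊆ s.cur) (hQ : s.C.Q = insert none (some '' (s.cur \ PT)))
    (hs : IsSynthesized sys S L s.C) :
    PT ⊆ s'.cur ∧ s'.C.Q = insert none (some '' (s'.cur \ PT)) ∧ IsSynthesized sys S L s'.C := by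
  set R := newSimplices sys S L s.cur with hR
  have hRcur : ∀ p ∈ R, p ∉ s.cur := fun p hp => hp.1.1
  have hmemQ : ∀ p, some p ∈ s.C.Q ↔ p ∈ s.cur \ PT := fun p => by
    rw [hQ, mem_insert_iff, (Option.some_injective P).mem_set_image]
    simp
  have hmemQ' : ∀ p, some p ∈ s'.C.Q ↔ some p ∈ s.C.Q ∨ p ∈ R := fun p => by
    rw [h.modes, mem_union, (Option.some_injective P).mem_set_image]
  have hQQ' : s.C.Q ⊆ s'.C.Q := by rw [h.modes]; exact subset_union_left
  have hnew : ∀ p ∈ R, some p ∉ s.C.Q := fun p hp hpQ => hRcur p hp ((hmemQ p).1 hpQ).1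
  have hnone : s'.C.D none = sys.XT := (h.domain_old _ hs.target_mem).trans hs.domain_target
  have hdom : ∀ p, some p ∈ s'.C.Q → s'.C.D (some p) = simplexBody (S p) := fun p hp =>
    ((hmemQ' p).1 hp).elim (fun hp => (h.domain_old _ hp).trans (hs.domain_simplex p hp))
      (h.domain_new p)
  have hEold : ∀ e ∈ s.C.E, e ∈ s'.C.E := fun e he => by
    rw [h.edges]
    exact Or.inl (Or.inl he)
  have hEsimplex : ∀ p ∈ R, ∀ p' ∈ s.cur \ PT, (commonFacets S p {p'}).Nonempty →
      (some p, some p') ∈ s'.C.E := fun p hp p' hp' hne => by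
    rw [h.edges]
    exact Or.inl (Or.inr ⟨p, hp, p', hp', hne, rfl⟩)
  have hEtarget : ∀ p ∈ R, (commonFacets S p PT).Nonempty → (some p, none) ∈ s'.C.E :=
    fun p hp hne => by
      rw [h.edges]
      exact Or.inr ⟨p, hp, hne, rfl⟩
  have hcompact : ∀ p (J : Set (Fin (n + 1))), IsCompact (⋃ j ∈ J, facet (S p) j) :=
    fun p J => J.toFinite.isCompact_biUnion fun j _ => isCompact_facet _ _
  have hEnew : ∀ e ∈ s'.C.E, e ∈ s.C.E ∨ ((∃ p ∈ R, e.1 = some p) ∧ e.2 ∈ s.C.Q ∧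
      s'.C.G e ⊆ s'.C.D e.1 ∩ s'.C.D e.2 ∧ IsCompact (s'.C.G e)) := by
    intro e he
    rw [h.edges] at he
    rcases he with (he | ⟨p, hp, p', hp', hne, rfl⟩) | ⟨p, hp, hne, rfl⟩
    · exact Or.inl he
    · have hpQ' : some p' ∈ s.C.Q := (hmemQ p').2 hp'
      refine Or.inr ⟨⟨p, hp, rfl⟩, hpQ', ?_, ?_⟩
      · rw [h.guard_new p hp p' hp' hne, h.domain_new p hp, hdom p' (hQQ' hpQ')]
        refine iUnion₂_subset fun j hj => subset_inter (facet_subset_simplexBody _ _) ?_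
        obtain ⟨_, rfl, j', hj'⟩ := hj
        rw [hj']
        exact facet_subset_simplexBody _ _
      · rw [h.guard_new p hp p' hp' hne]
        exact hcompact _ _
    · refine Or.inr ⟨⟨p, hp, rfl⟩, hs.target_mem, ?_, ?_⟩
      · rw [h.guard_target p hp hne, h.domain_new p hp, hnone]
        refine iUnion₂_subset fun j hj => subset_inter (facet_subset_simplexBody _ _) ?_
        obtain ⟨p', hp', j', hj'⟩ := hj
        rw [hj']
        exact (facet_subset_simplexBody _ _).trans (hPT p' hp')
      · rw [h.guard_target p hp hne]
        exact hcompact _ _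
  refine ⟨?_, ?_, ?_⟩
  · rw [h.cur]
    exact hsub.trans subset_union_left
  · have hdisj : R \ PT = R := sdiff_eq_left.2 (disjoint_left.2 fun p hp hpT =>
      hRcur p hp (hsub hpT))
    rw [h.modes, h.cur, hQ, union_sdiff_distrib, image_union, ← hR, hdisj, insert_union]
  · refine ⟨hQQ' hs.target_mem, hnone, ?_, hdom, ?_, ?_, ?_, ?_, ?_⟩
    · rw [h.control_old _ hs.target_mem]
      exact hs.control_target
    · intro p hp
      rcases (hmemQ' p).1 hp with hp | hp
      · obtain ⟨J, hJ, hJE⟩ := hs.exit_simplex p hp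
        refine ⟨J, by rwa [h.control_old _ hp], fun j hj => ?_⟩
        obtain ⟨q', hE, hG⟩ := hJE j hj
        exact ⟨q', hEold _ hE, by rwa [h.guard_old _ hE]⟩
      · refine ⟨_, h.control_new p hp, fun j hj => ?_⟩
        obtain ⟨p', hp', hj'⟩ := hj
        by_cases hT : p' ∈ PT
        · have hjT : j ∈ commonFacets S p PT := ⟨p', hT, hj'⟩
          refine ⟨none, hEtarget p hp ⟨j, hjT⟩, ?_⟩
          rw [h.guard_target p hp ⟨j, hjT⟩]
          exact subset_biUnion_of_mem (u := fun j => facet (S p) j) hjT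
        · have hjp : j ∈ commonFacets S p {p'} := ⟨p', rfl, hj'⟩
          refine ⟨some p', hEsimplex p hp p' ⟨hp', hT⟩ ⟨j, hjp⟩, ?_⟩
          rw [h.guard_new p hp p' ⟨hp', hT⟩ ⟨j, hjp⟩]
          exact subset_biUnion_of_mem (u := fun j => facet (S p) j) hjp
    · intro e he
      rcases hEnew e he with he | ⟨⟨p, hp, hep⟩, h2, -⟩
      · exact ⟨hQQ' (hs.edges he).1, hQQ' (hs.edges he).2⟩
      · exact ⟨by rw [hep]; exact (hmemQ' p).2 (Or.inr hp), hQQ' h2⟩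
    · intro e he
      rcases hEnew e he with he | ⟨-, -, hG, -⟩
      · rw [h.guard_old e he, h.domain_old _ (hs.edges he).1, h.domain_old _ (hs.edges he).2]
        exact hs.guard_subset e he
      · exact hG
    · intro e he
      rcases hEnew e he with he | ⟨-, -, -, hG⟩
      · rw [h.guard_old e he]
        exact hs.guard_compact e he
      · exact hG
    · classical
      obtain ⟨r, hr⟩ := hs.rank
      obtain ⟨B, hB⟩ := (finite_range r).bddAbove
      refine ⟨fun q => if q ∈ s.C.Q then r q else B + 1, fun e he => ?_⟩
      rcases hEnew e he with he | ⟨⟨p, hp, hep⟩, h2, -⟩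
      · simpa only [if_pos (hs.edges he).1, if_pos (hs.edges he).2] using hr e he
      · have h1 : e.1 ∉ s.C.Q := hep ▸ hnew p hp
        simpa only [if_neg h1, if_pos h2] using Nat.lt_succ_of_le (hB (mem_range_self e.2))

theorem ComputedByAlgorithm.isSynthesized [Finite P]
    (hPT : ∀ p ∈ PT, simplexBody (S p) ⊆ sys.XT) (hC : ComputedByAlgorithm sys S PT L C) :
    IsSynthesized sys S L C := by
  obtain ⟨s₀, s, h₀, hrun, -, rfl⟩ := hC
  have hinv : PT ⊆ s.cur ∧ s.C.Q = insert none (some '' (s.cur \ PT)) ∧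
      IsSynthesized sys S L s.C := by
    induction hrun with
    | refl => exact ⟨h₀.cur.ge, by simp [h₀.modes, h₀.cur], h₀.isSynthesized⟩
    | tail _ hstep ih => exact hstep.isSynthesized hPT ih.1 ih.2.1 ih.2.2
  exact hinv.2.2

/-! ### The controlled system -/

namespace IsSynthesized

theorem isHybridController [Finite P] (hC : IsSynthesized sys S L C)
    (hS : ∀ p, simplexBody (S p) ⊆ sys.X) : IsHybridController sys C where
  finite_modes := C.Q.toFinite
  edges := hC.edges
  domain_subset := by
    rintro (_ | p) hq
    · rw [hC.domain_target]
      exact sys.XT_subset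
    · rw [hC.domain_simplex p hq]
      exact hS p
  domain_compact := by
    rintro (_ | p) hq
    · rw [hC.domain_target]
      obtain ⟨t, ht, hXT⟩ := sys.XT_polytope
      rw [hXT]
      exact ht.isCompact_convexHull ℝ
    · rw [hC.domain_simplex p hq]
      exact isCompact_simplexBody _
  guard_subset := hC.guard_subset
  guard_compact := hC.guard_compact
  control_mapsTo := by
    rintro (_ | p) hq
    · rw [hC.domain_target]
      exact hC.control_target.mapsTo
    · rw [hC.domain_simplex p hq]
      obtain ⟨J, hJ, -⟩ := hC.exit_simplex p hq
      exact hJ.mapsTo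
  control_lipschitz := by
    rintro (_ | p) hq
    · rw [hC.domain_target]
      exact hC.control_target.lipschitz
    · obtain ⟨J, hJ, -⟩ := hC.exit_simplex p hq
      obtain ⟨K, k, hK⟩ := hJ.affine
      refine ⟨‖K‖₊, LipschitzWith.lipschitzOnWith ?_⟩
      rw [show C.h (some p) = fun x => K x + k from funext hK]
      simpa using K.lipschitz.add (LipschitzWith.const k)

/-- An execution has finitely many transitions, since each of them lowers the rank of the mode. -/
theorem ne_top {e : HybridPath n (Option P)} (hC : IsSynthesized sys S L C)
    (he : IsExecution sys C e) : e.N ≠ ⊤ := by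
  intro hN
  obtain ⟨r, hr⟩ := hC.rank
  have hdec : StrictAnti fun i => r (e.q i) :=
    strictAnti_nat_of_succ_lt fun i => hr _ (he.jump i (by rw [hN]; exact ENat.natCast_lt_top i)).1
  exact not_strictAnti_of_wellFoundedLT _ hdec

theorem isNonZeno (hC : IsSynthesized sys S L C) : IsNonZeno sys C :=
  fun _ he hz => hC.ne_top he hz.1

/-- A finite execution whose last mode is a simplex is prolonged to a facet in `J` and continued by a
transition; by induction on the rank of the last mode, the target mode is reached, where a solution
of the invariance problem is followed forever. -/
theorem isNonBlocking [Finite P] (hC : IsSynthesized sys S L C)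
    (hS : ∀ p, simplexBody (S p) ⊆ sys.X) (hL : IsHybridization sys S L) :
    IsNonBlocking sys C := by
  have hctrl := hC.isHybridController hS
  obtain ⟨r, hr⟩ := hC.rank
  have main : ∀ k N : ℕ, ∀ e : HybridPath n (Option P), IsExecution sys C e → e.N = N →
      ¬ e.unbounded → r (e.q N) = k →
      ∃ e' : HybridPath n (Option P), IsExecution sys C e' ∧ e'.IsInfinite ∧ e'.Extends e := by
    intro k
    induction k using Nat.strong_induction_on with
    | _ k ih =>
      intro N e he hN hu hk
      have hend := (he.forall_mem_τ_hasDerivWithinAt hctrl hN.ge (fun h => hu h.2)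
        (e.t (N + 1)) ⟨he.times N hN.ge fun h => hu h.2, le_rfl⟩).1
      have hmode := he.modes N hN.ge
      rcases hq : e.q N with _ | p
      · rw [hq, hC.domain_target] at hend
        obtain ⟨y, hy0, hy⟩ := hC.control_target.solution _ hend
        obtain ⟨e', he', hext, -, hunb, -⟩ := he.exists_prolongation hctrl hN hu True le_rfl hy0 (by
          rw [hq, hC.domain_target]
          simpa [Ici] using hy)
        exact ⟨e', he', Or.inr (hunb ▸ trivial), hext⟩
      · rw [hq] at hmode
        rw [hq, hC.domain_simplex p hmode] at hend
        obtain ⟨J, hJ, hJE⟩ := hC.exit_simplex p hmode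
        obtain ⟨T, y, hT, hy0, hy, j, hj, hyT⟩ :=
          hJ.exists_solution_reaching_facet (hS p) (hL p) hend
        obtain ⟨q', hE, hG⟩ := hJE j hj
        obtain ⟨e₁, he₁, hext₁, hN₁, hunb₁, hq₁, hx₁⟩ :=
          he.exists_prolongation hctrl hN hu False hT hy0 (by
            rw [hq, hC.domain_simplex p hmode]
            simpa [Icc] using hy)
        rw [hq] at hq₁
        obtain ⟨e₂, he₂, hext₂, hN₂, hu₂, hq₂⟩ := he₁.exists_append hctrl hN₁
          (by simp [hunb₁]) (q' := q') (by rwa [hq₁]) (by rw [hq₁, hx₁]; exact hG hyT)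
        obtain ⟨e₃, he₃, hinf, hext₃⟩ := ih (r q') (by rw [← hk, hq]; exact hr _ hE) (N + 1) e₂
          he₂ hN₂ hu₂ (by rw [hq₂])
        exact ⟨e₃, he₃, hinf, (hext₃.trans hext₂).trans hext₁⟩
  intro e he hfin
  obtain ⟨N, hN⟩ := ENat.ne_top_iff_exists.1 (hC.ne_top he)
  exact main _ N e he hN.symm (fun h => hfin (Or.inr h)) rfl

/-- The unbounded last interval cannot be spent in a simplex, where the exit problem is solved, so
the last mode is the target mode. -/
theorem reachesTarget (hC : IsSynthesized sys S L C)
    (hS : ∀ p, simplexBody (S p) ⊆ sys.X) (hL : IsHybridization sys S L) :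
    ReachesTarget sys C := by
  intro e he hinf
  obtain ⟨N, hN⟩ := ENat.ne_top_iff_exists.1 (hC.ne_top he)
  have hu : e.unbounded := hinf.resolve_left (hC.ne_top he)
  have hunb : e.IsUnboundedAt N := ⟨hN, hu⟩
  have hτ : e.τ N = Ici (e.t N) := by ext s; simp [HybridPath.τ, hunb]
  have hτo : e.τOpen N = Ici (e.t N) := by ext s; simp [HybridPath.τOpen, hunb]
  have hflow := he.flow N hN.le
  have hmode := he.modes N hN.le
  rw [hτ, hτo] at hflow
  rcases hq : e.q N with _ | p
  · refine ⟨N, hN.le, fun i hi hiN s hs => ?_⟩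
    obtain rfl : i = N := le_antisymm ((Nat.cast_le (α := ℕ∞)).1 (hN ▸ hiN)) hi
    rw [hτ] at hs
    have := (hflow s hs).1
    rwa [hq, hC.domain_target] at this
  · rw [hq] at hmode hflow
    rw [hC.domain_simplex p hmode] at hflow
    obtain ⟨J, hJ, -⟩ := hC.exit_simplex p hmode
    have hshift : MapsTo (fun s => s + e.t N) (Ici 0) (Ici (e.t N)) := fun s hs =>
      le_add_of_nonneg_left (mem_Ici.1 hs)
    refine absurd (fun t ht => (hflow _ (hshift ht)).1)
      (hJ.not_forall_mem (hS p) (hL p) (x := fun s => e.x N (s + e.t N)) fun t ht => ?_)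
    have := (hflow _ (hshift ht)).2.scomp t ((hasDerivWithinAt_id t _).add_const (e.t N)) hshift
    simpa [Function.comp_def] using this

end IsSynthesized

end Algorithm

theorem mainTheorem1 {n m : ℕ} {P : Type*} [Finite P] (sys : ControlSystem n m)
    (S : P → Affine.Simplex ℝ (Vec n) n) (hS : IsTriangulation S sys.X)
    (PT : Set P) (hPT : IsTriangulation (fun p : PT => S p) sys.XT)
    (L : P → DisturbedAffineSystem n m) (hL : IsHybridization sys S L)
    (C : HybridControllerData n m (Option P)) (hC : ComputedByAlgorithm sys S PT L C)
    (hcover : sys.XI ⊆ ⋃ q ∈ C.Q, C.D q) :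
    SolvesSynthesisProblem sys C := by
  have hSX : ∀ p, simplexBody (S p) ⊆ sys.X := fun p =>
    (subset_iUnion (fun p => simplexBody (S p)) p).trans hS.2.le
  have hPTX : ∀ p ∈ PT, simplexBody (S p) ⊆ sys.XT := fun p hp =>
    (subset_iUnion (fun p : PT => simplexBody (S p)) ⟨p, hp⟩).trans hPT.2.le
  have hsyn := hC.isSynthesized hPTX
  exact ⟨hsyn.isHybridController hSX, hcover, hsyn.isNonBlocking hSX hL, hsyn.isNonZeno,
    hsyn.reachesTarget hSX hL⟩
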